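/- Let $R$ be an integral domain with quotient field $F$. For a nonzero fractional ideal $I$ of $R$ put $I^{-1}=\{x\in F: xI\subseteq R\}$, $I_v=(I^{-1})^{-1}$ and $I_t=\bigcup\{J_v : 0\ne J\subseteq I,\ J \text{ a finitely generated fractional ideal}\}$. A nonzero ideal $I\subseteq R$ is a $t$-ideal if $I_t=I$, and it is $t$-invertible if $(II^{-1})_t=R$; two $t$-ideals $I,J$ are $t$-comaximal if $(I+J)_t=R$. A packet is a $t$-invertible $t$-ideal $I\subseteq R$ having exactly one minimal prime ideal. The domain $R$ is called a unique representation domain (URD) if every $t$-invertible $t$-ideal $I\subsetneq R$ can be expressed, uniquely up to the order of the factors, as a $t$-product $I=(X_1X_2\cdots X_n)_t$ of finitely many mutually $t$-comaximal packets $X_1,\dots,X_n$. Let $D$ be an integral domain with quotient field $K$ and let $X$ be an indeterminate over $D$. Then the ring $D+XK[X]=\{f\in K[X] : f(0)\in D\}$ is a URD if and only if $D$ is a URD. -/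

import Mathlib

open scoped nonZeroDivisors Polynomial

namespace URD

/-- The `v`-closure (divisorial closure) `I_v = (I⁻¹)⁻¹` of a fractional ideal `I` of `R`, where
`J⁻¹ = (R : J) = {x ∈ K : xJ ⊆ R}` for nonzero `J` (with the convention `0_v = 0`). -/
noncomputable def vClosure {R : Type*} [CommRing R] [IsDomain R] {K : Type*} [Field K]
    [Algebra R K] [IsFractionRing R K] (I : FractionalIdeal R⁰ K) : FractionalIdeal R⁰ K :=
  1 / (1 / I)

theorem vClosure_zero {R : Type*} [CommRing R] [IsDomain R] {K : Type*} [Field K]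
    [Algebra R K] [IsFractionRing R K] : vClosure (0 : FractionalIdeal R⁰ K) = 0 := by
  simp [vClosure]

theorem one_div_ne_zero' {R : Type*} [CommRing R] [IsDomain R] {K : Type*} [Field K]
    [Algebra R K] [IsFractionRing R K] {I : FractionalIdeal R⁰ K} (hI : I ≠ 0) :
    1 / I ≠ 0 := by
  obtain ⟨a, J, ha, hJ⟩ := FractionalIdeal.exists_eq_spanSingleton_mul I
  have hmem : algebraMap R K a ∈ 1 / I := by
    rw [FractionalIdeal.mem_div_iff_of_ne_zero hI]
    intro y hy
    rw [hJ, FractionalIdeal.mem_singleton_mul] at hy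
    obtain ⟨z, hz, rfl⟩ := hy
    have ha' : algebraMap R K a ≠ 0 := by simpa using ha
    rw [← mul_assoc, mul_inv_cancel₀ ha', one_mul]
    exact FractionalIdeal.coeIdeal_le_one hz
  intro h
  rw [h] at hmem
  exact ha (by simpa using hmem)

theorem vClosure_mono {R : Type*} [CommRing R] [IsDomain R] {K : Type*} [Field K]
    [Algebra R K] [IsFractionRing R K] {I J : FractionalIdeal R⁰ K} (h : I ≤ J) :
    vClosure I ≤ vClosure J := by
  by_cases hI : I = 0
  · rw [hI, vClosure_zero]
    exact FractionalIdeal.zero_le _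
  have hJ : J ≠ 0 := fun h0 => hI (le_antisymm (h0 ▸ h) (FractionalIdeal.zero_le _))
  intro x hx
  change x ∈ 1 / (1 / J)
  change x ∈ 1 / (1 / I) at hx
  rw [FractionalIdeal.mem_div_iff_of_ne_zero (one_div_ne_zero' hJ)]
  rw [FractionalIdeal.mem_div_iff_of_ne_zero (one_div_ne_zero' hI)] at hx
  intro y hy
  apply hx
  rw [FractionalIdeal.mem_div_iff_of_ne_zero hJ] at hy
  rw [FractionalIdeal.mem_div_iff_of_ne_zero hI]
  exact fun z hz => hy z (h hz)

/-- The `t`-closure `I_t = ⋃ {J_v : J ⊆ I, J finitely generated}` of a fractional ideal `I`. -/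
noncomputable def tClosure {R : Type*} [CommRing R] [IsDomain R] {K : Type*} [Field K]
    [Algebra R K] [IsFractionRing R K] (I : FractionalIdeal R⁰ K) : FractionalIdeal R⁰ K :=
  ⟨{ carrier := {x | ∃ J : FractionalIdeal R⁰ K,
        J ≤ I ∧ (J : Submodule R K).FG ∧ x ∈ vClosure J}
     zero_mem' := ⟨0, FractionalIdeal.zero_le _, by simpa using Submodule.fg_bot,
        FractionalIdeal.zero_mem _⟩
     add_mem' := by
        rintro x y ⟨J₁, h₁, f₁, hx⟩ ⟨J₂, h₂, f₂, hy⟩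
        refine ⟨J₁ ⊔ J₂, sup_le h₁ h₂, ?_, ?_⟩
        · rw [FractionalIdeal.coe_sup]
          exact f₁.sup f₂
        · exact (vClosure (J₁ ⊔ J₂) : Submodule R K).add_mem
            (vClosure_mono le_sup_left hx) (vClosure_mono le_sup_right hy)
     smul_mem' := by
        rintro c x ⟨J, h, f, hx⟩
        exact ⟨J, h, f, (vClosure J : Submodule R K).smul_mem c hx⟩ }, by
    obtain ⟨a, ha, h⟩ := (vClosure I).isFractional
    refine ⟨a, ha, ?_⟩
    rintro x ⟨J, hJ, -, hx⟩
    exact h x (vClosure_mono hJ hx)⟩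

theorem mem_tClosure {R : Type*} [CommRing R] [IsDomain R] {K : Type*} [Field K]
    [Algebra R K] [IsFractionRing R K] {I : FractionalIdeal R⁰ K} {x : K} :
    x ∈ tClosure I ↔ ∃ J : FractionalIdeal R⁰ K,
      J ≤ I ∧ (J : Submodule R K).FG ∧ x ∈ vClosure J :=
  Iff.rfl

/-- An ideal `I` of the domain `R`, viewed as a fractional ideal in the quotient field of `R`. -/
noncomputable abbrev toFrac {R : Type*} [CommRing R] [IsDomain R] (I : Ideal R) :
    FractionalIdeal R⁰ (FractionRing R) :=
  (I : FractionalIdeal R⁰ (FractionRing R))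

/-- A (nonzero, integral) `t`-ideal: `I ≠ 0` and `I_t = I`. -/
def IsTIdeal {R : Type*} [CommRing R] [IsDomain R] (I : Ideal R) : Prop :=
  I ≠ ⊥ ∧ tClosure (toFrac I) = toFrac I

/-- `I` is `t`-invertible: `I ≠ 0` and `(I I⁻¹)_t = R`. -/
def IsTInvertible {R : Type*} [CommRing R] [IsDomain R] (I : Ideal R) : Prop :=
  I ≠ ⊥ ∧ tClosure (toFrac I * (1 / toFrac I)) = 1

/-- `I` and `J` are `t`-comaximal: `(I + J)_t = R`. -/
def IsTComaximal {R : Type*} [CommRing R] [IsDomain R] (I J : Ideal R) : Prop :=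
  tClosure (toFrac (I ⊔ J)) = 1

/-- A packet: a `t`-invertible `t`-ideal `I ⊆ R` having a unique minimal prime ideal. -/
def IsPacket {R : Type*} [CommRing R] [IsDomain R] (I : Ideal R) : Prop :=
  IsTInvertible I ∧ IsTIdeal I ∧ ∃! P : Ideal R, P ∈ I.minimalPrimes

/-- The finite family `s` (with repetitions allowed, up to order) is a factorization of `I` as a
`t`-product of mutually `t`-comaximal packets: `I = (X₁ X₂ ⋯ Xₙ)_t`. -/
def IsPacketFactorization {R : Type*} [CommRing R] [IsDomain R] (I : Ideal R)
    (s : Multiset (Ideal R)) : Prop :=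
  (∀ X ∈ s, IsPacket X) ∧ s.Pairwise IsTComaximal ∧ toFrac I = tClosure (toFrac s.prod)

/-- `R` is a unique representation domain: every proper `t`-invertible `t`-ideal of `R` can be
expressed, uniquely up to order, as a `t`-product of finitely many mutually `t`-comaximal
packets. -/
def IsURD (R : Type*) [CommRing R] [IsDomain R] : Prop :=
  ∀ I : Ideal R, I ≠ ⊤ → IsTInvertible I → IsTIdeal I →
    ∃! s : Multiset (Ideal R), IsPacketFactorization I s

/-- The ring `D + X K[X]`: the subring of `K[X]` of the polynomials whose constant coefficient
lies in `D`. -/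
noncomputable def compositeRing (D : Type*) [CommRing D] (K : Type*) [Field K] [Algebra D K] :
    Subring K[X] :=
  (algebraMap D K).range.comap Polynomial.constantCoeff

theorem mem_compositeRing {D : Type*} [CommRing D] {K : Type*} [Field K] [Algebra D K]
    {f : K[X]} : f ∈ compositeRing D K ↔
      ∃ (d : D) (g : K[X]), f = Polynomial.C (algebraMap D K d) + Polynomial.X * g := by
  constructor
  · rintro ⟨d, hd⟩
    refine ⟨d, f.divX, ?_⟩
    rw [hd, Polynomial.constantCoeff_apply, add_comm]
    exact (Polynomial.X_mul_divX_add f).symm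
  · rintro ⟨d, g, rfl⟩
    exact ⟨d, by simp⟩

end URD

/-! Write R = D + XK[X]. Uniqueness is automatic in every domain: t-comaximality depends only on
radicals, so the factors of two packet factorizations are matched by their prime radicals, and
matched factors contain each other (`IsPacketFactorization.unique`). Only existence matters.

Taking constant terms retracts R onto D. For J ≠ 0 the map J ↦ J + XK[X] = JR commutes with
products, sums and t-closure, and it preserves and reflects t-invertibility and packets. Ideals
containing XK[X] are pulled back from D, so packet factorizations of J and of JR correspond
(`hasPacketFactorization_comap_iff`), and D inherits the property from R.

Conversely, as K[X] is principal, a nonzero ideal of R is hB with h(0) = 1 and X^(r+1)K[X] ⊆ B ⊆ X^r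
K[X] (`exists_eq_span_mul`). Since h and B are comaximal, they may be factored separately. The
factorization of h in K[X], normalized to constant terms 1, yields principal packets. If r > 0, then
rad B = XK[X] is prime and B is a packet; if r = 0, then B = JR and J is factored in D. -/

set_option linter.unusedSectionVars false

namespace URD

/-! ### The v- and t-operations on integral ideals, expressed by divisibility. -/

section Intrinsic

variable {R : Type*} [CommRing R]

/-- The divisorial closure of an ideal, described without leaving the ring. -/
def vIdeal (J : Ideal R) : Ideal R where
  carrier := {x | ∀ a b : R, b ≠ 0 → (∀ j ∈ J, b ∣ a * j) → b ∣ a * x}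
  zero_mem' := fun a b _ _ => by simp
  add_mem' := fun hx hy a b hb h => by
    rw [mul_add]
    exact dvd_add (hx a b hb h) (hy a b hb h)
  smul_mem' := fun c x hx a b hb h => by
    rw [smul_eq_mul, mul_left_comm]
    exact (hx a b hb h).mul_left c

theorem le_vIdeal (J : Ideal R) : J ≤ vIdeal J := fun x hx _ _ _ h => h x hx

theorem vIdeal_mono {I J : Ideal R} (h : I ≤ J) : vIdeal I ≤ vIdeal J :=
  fun _ hx a b hb hJ => hx a b hb fun j hj => hJ j (h hj)

theorem vIdeal_vIdeal (J : Ideal R) : vIdeal (vIdeal J) = vIdeal J :=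
  le_antisymm (fun _ hx a b hb hJ => hx a b hb fun _ hj => hj a b hb hJ) (le_vIdeal _)

theorem mul_mem_vIdeal {I J : Ideal R} {x y : R} (hx : x ∈ vIdeal I) (hy : y ∈ vIdeal J) :
    x * y ∈ vIdeal (I * J) := by
  intro a b hb h
  rw [← mul_assoc]
  refine hy (a * x) b hb fun j hj => ?_
  rw [mul_right_comm]
  refine hx (a * j) b hb fun i hi => ?_
  rw [mul_assoc, mul_comm j]
  exact h _ (Ideal.mul_mem_mul hi hj)

/-- The `t`-closure of an ideal, described without leaving the ring. -/
def tIdeal (I : Ideal R) : Ideal R where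
  carrier := {x | ∃ J ≤ I, J.FG ∧ x ∈ vIdeal J}
  zero_mem' := ⟨⊥, bot_le, Submodule.fg_bot, zero_mem _⟩
  add_mem' := by
    rintro x y ⟨J₁, h₁, f₁, hx⟩ ⟨J₂, h₂, f₂, hy⟩
    exact ⟨J₁ ⊔ J₂, sup_le h₁ h₂, Submodule.FG.sup f₁ f₂,
      add_mem (vIdeal_mono le_sup_left hx) (vIdeal_mono le_sup_right hy)⟩
  smul_mem' := by
    rintro c x ⟨J, h, f, hx⟩
    exact ⟨J, h, f, Ideal.mul_mem_left _ c hx⟩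

theorem le_tIdeal (I : Ideal R) : I ≤ tIdeal I := fun x hx =>
  ⟨Ideal.span {x}, (Ideal.span_singleton_le_iff_mem I).2 hx, Submodule.fg_span_singleton x,
    le_vIdeal _ (Ideal.mem_span_singleton_self x)⟩

theorem tIdeal_mono {I J : Ideal R} (h : I ≤ J) : tIdeal I ≤ tIdeal J := by
  rintro x ⟨A, hA, f, hx⟩
  exact ⟨A, hA.trans h, f, hx⟩

theorem tIdeal_le_vIdeal (I : Ideal R) : tIdeal I ≤ vIdeal I := by
  rintro x ⟨A, hA, -, hx⟩
  exact vIdeal_mono hA hx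

/-- Finite character: finitely many elements of the t-closure share one finitely generated witness.
Idempotence of `tIdeal` rests on this. -/
theorem exists_fg_le_vIdeal {I J : Ideal R} (hJ : J.FG) (h : J ≤ tIdeal I) :
    ∃ A ≤ I, A.FG ∧ J ≤ vIdeal A := by
  induction J, hJ using Submodule.fg_induction with
  | singleton x =>
    obtain ⟨A, hA, f, hx⟩ := h (Submodule.mem_span_singleton_self x)
    exact ⟨A, hA, f, (Submodule.span_singleton_le_iff_mem _ _).2 hx⟩
  | sup J₁ J₂ f₁ f₂ h₁ h₂ =>
    obtain ⟨A₁, hA₁, g₁, k₁⟩ := h₁ (le_sup_left.trans h)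
    obtain ⟨A₂, hA₂, g₂, k₂⟩ := h₂ (le_sup_right.trans h)
    exact ⟨A₁ ⊔ A₂, sup_le hA₁ hA₂, Submodule.FG.sup g₁ g₂, sup_le (k₁.trans (vIdeal_mono le_sup_left))
      (k₂.trans (vIdeal_mono le_sup_right))⟩

theorem tIdeal_tIdeal (I : Ideal R) : tIdeal (tIdeal I) = tIdeal I := by
  refine le_antisymm ?_ (le_tIdeal _)
  rintro x ⟨J, hJ, f, hx⟩
  obtain ⟨A, hA, g, k⟩ := exists_fg_le_vIdeal f hJ
  refine ⟨A, hA, g, ?_⟩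
  rw [← vIdeal_vIdeal]
  exact vIdeal_mono k hx

theorem mul_mem_tIdeal {I J : Ideal R} {x y : R} (hx : x ∈ tIdeal I) (hy : y ∈ tIdeal J) :
    x * y ∈ tIdeal (I * J) := by
  obtain ⟨A, hA, f, hx⟩ := hx
  obtain ⟨B, hB, g, hy⟩ := hy
  exact ⟨A * B, Ideal.mul_mono hA hB, f.mul g, mul_mem_vIdeal hx hy⟩

theorem tIdeal_mul_tIdeal (I J : Ideal R) : tIdeal (tIdeal I * tIdeal J) = tIdeal (I * J) := by
  refine le_antisymm ?_ (tIdeal_mono (Ideal.mul_mono (le_tIdeal I) (le_tIdeal J)))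
  rw [← tIdeal_tIdeal (I * J)]
  exact tIdeal_mono (Ideal.mul_le.2 fun _ hx _ hy => mul_mem_tIdeal hx hy)

theorem tIdeal_top : tIdeal (⊤ : Ideal R) = ⊤ := top_le_iff.1 (le_tIdeal ⊤)

theorem tIdeal_sup_mul {X Y Z : Ideal R} (hY : tIdeal (X ⊔ Y) = ⊤) (hZ : tIdeal (X ⊔ Z) = ⊤) :
    tIdeal (X ⊔ Y * Z) = ⊤ := by
  rw [Ideal.eq_top_iff_one] at hY hZ ⊢
  have h := mul_mem_tIdeal hY hZ
  rw [one_mul] at h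
  have hle : (X ⊔ Y) * (X ⊔ Z) ≤ X ⊔ Y * Z := by
    rw [Ideal.sup_mul, Ideal.mul_sup Y]
    exact sup_le (Ideal.mul_le_left.trans le_sup_left)
      (sup_le (Ideal.mul_le_right.trans le_sup_left) le_sup_right)
  exact tIdeal_mono hle h

theorem tIdeal_sup_multiset_prod {X : Ideal R} {s : Multiset (Ideal R)}
    (h : ∀ Y ∈ s, tIdeal (X ⊔ Y) = ⊤) : tIdeal (X ⊔ s.prod) = ⊤ := by
  induction s using Multiset.induction_on with
  | empty => simp [tIdeal_top, Ideal.one_eq_top]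
  | cons Y s ih =>
    rw [Multiset.prod_cons]
    exact tIdeal_sup_mul (h Y (Multiset.mem_cons_self Y s))
      (ih fun Z hZ => h Z (Multiset.mem_cons_of_mem hZ))

/-- A finitely generated A ⊆ I has 1 in its v-closure; some power of A lies in J, and that power
still has 1 in its v-closure. Hence t-comaximality sees only radicals. -/
theorem tIdeal_eq_top_of_le_radical {I J : Ideal R} (hI : tIdeal I = ⊤) (h : I ≤ J.radical) :
    tIdeal J = ⊤ := by
  obtain ⟨A, hA, f, hx⟩ : (1 : R) ∈ tIdeal I := hI ▸ Submodule.mem_top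
  obtain ⟨n, hn⟩ := Ideal.exists_pow_le_of_le_radical_of_fg (hA.trans h) f
  rw [Ideal.eq_top_iff_one]
  refine ⟨A ^ n, hn, f.pow, ?_⟩
  clear hn
  induction n with
  | zero => simp [Ideal.one_eq_top, le_vIdeal _ Submodule.mem_top]
  | succ n ih =>
    rw [pow_succ, ← mul_one (1 : R)]
    exact mul_mem_vIdeal ih hx

theorem mul_mem_tIdeal_span_mul_iff [IsDomain R] {c : R} (hc : c ≠ 0) {I : Ideal R} {x : R} :
    c * x ∈ tIdeal (Ideal.span {c} * I) ↔ x ∈ tIdeal I := by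
  constructor
  · rintro ⟨J, hJ, f, hx⟩
    -- The comap is c⁻¹J, which is integral because J ⊆ cR.
    have hJ' : Ideal.span {c} * (Submodule.comap (LinearMap.mulLeft R c) J) = J := by
      apply le_antisymm
      · rw [Ideal.span_singleton_mul_le_iff]
        exact fun y hy => hy
      · intro y hy
        obtain ⟨z, -, rfl⟩ := Ideal.mem_span_singleton_mul.1 (hJ hy)
        exact Ideal.mem_span_singleton_mul.2 ⟨z, hy, rfl⟩
    refine ⟨Submodule.comap (LinearMap.mulLeft R c) J, ?_, ?_, ?_⟩
    · intro y hy
      obtain ⟨z, hz, hzy⟩ := Ideal.mem_span_singleton_mul.1 (hJ hy)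
      rwa [← mul_left_cancel₀ hc hzy]
    · refine Submodule.fg_of_fg_map_injective (LinearMap.mulLeft R c)
        (fun _ _ h => mul_left_cancel₀ hc h) ?_
      rwa [Submodule.map_comap_eq_of_le]
      intro y hy
      obtain ⟨z, -, rfl⟩ := Ideal.mem_span_singleton_mul.1 (hJ hy)
      exact ⟨z, rfl⟩
    · intro a b hb h
      have := hx a (c * b) (mul_ne_zero hc hb) fun j hj => by
        rw [← hJ'] at hj
        obtain ⟨z, hz, rfl⟩ := Ideal.mem_span_singleton_mul.1 hj
        rw [mul_left_comm]
        exact mul_dvd_mul_left c (h z hz)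
      rw [mul_left_comm] at this
      exact (mul_dvd_mul_iff_left hc).1 this
  · intro hx
    exact mul_mem_tIdeal (le_tIdeal _ (Ideal.mem_span_singleton_self c)) hx

theorem span_mul_tIdeal [IsDomain R] {c : R} (hc : c ≠ 0) (I : Ideal R) :
    tIdeal (Ideal.span {c} * I) = Ideal.span {c} * tIdeal I := by
  refine le_antisymm (fun x hx => ?_) ?_
  · have h : c ∣ 1 * x := tIdeal_le_vIdeal _ hx 1 c hc fun j hj => by
      obtain ⟨z, -, rfl⟩ := Ideal.mem_span_singleton_mul.1 hj
      simp
    rw [one_mul] at h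
    obtain ⟨y, rfl⟩ := h
    exact Ideal.mul_mem_mul (Ideal.mem_span_singleton_self c)
      ((mul_mem_tIdeal_span_mul_iff hc).1 hx)
  · rw [Ideal.span_singleton_mul_le_iff]
    exact fun y hy => (mul_mem_tIdeal_span_mul_iff hc).2 hy

end Intrinsic

/-! ### Comparison with the fractional-ideal definitions. -/

section Bridge

variable {R : Type*} [CommRing R] [IsDomain R]

/-- Explains the shape of `vIdeal`: its pairs (a, b) run through the fractions a/b of J⁻¹. -/
theorem mem_one_div_toFrac {J : Ideal R} (hJ : J ≠ ⊥) {a b : R} (hb : b ≠ 0) :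
    algebraMap R (FractionRing R) a / algebraMap R (FractionRing R) b ∈ 1 / toFrac J ↔
      ∀ j ∈ J, b ∣ a * j := by
  have hb' : algebraMap R (FractionRing R) b ≠ 0 := by simpa using hb
  rw [FractionalIdeal.mem_div_iff_of_ne_zero (by simpa using hJ)]
  have key : ∀ j : R, algebraMap R (FractionRing R) a / algebraMap R (FractionRing R) b *
      algebraMap R (FractionRing R) j ∈ (1 : FractionalIdeal R⁰ (FractionRing R)) ↔
      b ∣ a * j := by
    intro j
    rw [FractionalIdeal.mem_one_iff]
    constructor
    · rintro ⟨c, hc⟩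
      refine ⟨c, IsFractionRing.injective R (FractionRing R) ?_⟩
      rw [map_mul, map_mul, hc]
      field_simp
    · rintro ⟨c, hc⟩
      refine ⟨c, ?_⟩
      rw [div_mul_eq_mul_div, eq_div_iff hb', ← map_mul, ← map_mul, hc, mul_comm]
  constructor
  · intro h j hj
    exact (key j).1 (h _ (FractionalIdeal.mem_coeIdeal_of_mem _ hj))
  · rintro h y hy
    obtain ⟨j, hj, rfl⟩ := (FractionalIdeal.mem_coeIdeal _).1 hy
    exact (key j).2 (h j hj)

theorem one_div_toFrac_ne_zero {J : Ideal R} (hJ : J ≠ ⊥) : 1 / toFrac J ≠ 0 :=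
  one_div_ne_zero' (by simpa using hJ)

theorem algebraMap_mem_vClosure_iff {J : Ideal R} (hJ : J ≠ ⊥) {x : R} :
    algebraMap R (FractionRing R) x ∈ vClosure (toFrac J) ↔ x ∈ vIdeal J := by
  have h0 := one_div_toFrac_ne_zero hJ
  rw [vClosure, FractionalIdeal.mem_div_iff_of_ne_zero h0]
  have key : ∀ a b : R, b ≠ 0 → (algebraMap R (FractionRing R) x *
      (algebraMap R (FractionRing R) a / algebraMap R (FractionRing R) b) ∈
        (1 : FractionalIdeal R⁰ (FractionRing R)) ↔ b ∣ a * x) := by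
    intro a b hb
    have hb' : algebraMap R (FractionRing R) b ≠ 0 := by simpa using hb
    rw [FractionalIdeal.mem_one_iff]
    constructor
    · rintro ⟨c, hc⟩
      refine ⟨c, IsFractionRing.injective R (FractionRing R) ?_⟩
      rw [map_mul, map_mul, hc]
      field_simp
    · rintro ⟨c, hc⟩
      refine ⟨c, ?_⟩
      rw [← mul_div_assoc, eq_div_iff hb', ← map_mul, ← map_mul, mul_comm x, hc, mul_comm]
  constructor
  · intro h a b hb hJb
    exact (key a b hb).1 (h _ ((mem_one_div_toFrac hJ hb).2 hJb))
  · intro h y hy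
    obtain ⟨a, b, hb, rfl⟩ := IsFractionRing.div_surjective (A := R) y
    have hb : b ≠ 0 := nonZeroDivisors.ne_zero hb
    exact (key a b hb).2 (h a b hb ((mem_one_div_toFrac hJ hb).1 hy))

theorem vClosure_toFrac_le_one (J : Ideal R) : vClosure (toFrac J) ≤ 1 := by
  by_cases hJ : J = ⊥
  · rw [hJ, toFrac, FractionalIdeal.coeIdeal_bot, vClosure_zero]
    exact FractionalIdeal.zero_le _
  intro x hx
  change x ∈ vClosure (toFrac J) at hx
  have h0 := one_div_toFrac_ne_zero hJ
  rw [vClosure, FractionalIdeal.mem_div_iff_of_ne_zero h0] at hx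
  have h1 : (1 : FractionRing R) ∈ 1 / toFrac J := by
    simpa using (mem_one_div_toFrac (a := 1) hJ one_ne_zero).2 fun j _ => one_dvd _
  simpa using hx 1 h1

theorem tClosure_toFrac {I : Ideal R} (hI : I ≠ ⊥) :
    tClosure (toFrac I) = toFrac (tIdeal I) := by
  ext x
  rw [mem_tClosure]
  constructor
  · rintro ⟨J, hJ, f, hx⟩
    obtain ⟨J, rfl⟩ := FractionalIdeal.le_one_iff_exists_coeIdeal.1
      (hJ.trans FractionalIdeal.coeIdeal_le_one)
    obtain ⟨y, rfl⟩ := (FractionalIdeal.mem_one_iff _).1 (vClosure_toFrac_le_one J hx)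
    refine FractionalIdeal.mem_coeIdeal_of_mem _ ?_
    by_cases hJ0 : J = ⊥
    · rw [hJ0, FractionalIdeal.coeIdeal_bot, vClosure_zero, FractionalIdeal.mem_zero_iff] at hx
      rw [show y = 0 by simpa using hx]
      exact zero_mem _
    refine ⟨J, (FractionalIdeal.coeIdeal_le_coeIdeal _).1 hJ, ?_,
      (algebraMap_mem_vClosure_iff hJ0).1 hx⟩
    exact (FractionalIdeal.coeIdeal_fg R⁰ (IsFractionRing.injective R (FractionRing R)) J).1 f
  · intro hx
    obtain ⟨y, ⟨J, hJ, f, hy⟩, rfl⟩ := (FractionalIdeal.mem_coeIdeal _).1 hx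
    -- The witness J may be zero, where the two closures can differ: over a field `vIdeal ⊥` is `⊤`,
    -- while `vClosure 0 = 0`. Adjoining a nonzero a ∈ I avoids this.
    obtain ⟨a, ha, ha0⟩ := Submodule.exists_mem_ne_zero_of_ne_bot hI
    refine ⟨toFrac (J ⊔ Ideal.span {a}), ?_, ?_, ?_⟩
    · exact (FractionalIdeal.coeIdeal_le_coeIdeal _).2
        (sup_le hJ ((Ideal.span_singleton_le_iff_mem I).2 ha))
    · exact (FractionalIdeal.coeIdeal_fg R⁰ (IsFractionRing.injective R (FractionRing R)) _).2
        (Submodule.FG.sup f (Submodule.fg_span_singleton a))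
    · refine (algebraMap_mem_vClosure_iff ?_).2 (vIdeal_mono le_sup_left hy)
      exact fun h => ha0 (by
        simpa using (le_sup_right.trans h.le) (Ideal.mem_span_singleton_self a))

theorem isTIdeal_iff {I : Ideal R} : IsTIdeal I ↔ I ≠ ⊥ ∧ tIdeal I = I := by
  refine and_congr_right fun hI => ?_
  rw [tClosure_toFrac hI, FractionalIdeal.coeIdeal_inj]

theorem tClosure_toFrac_eq_one_iff {I : Ideal R} (hI : I ≠ ⊥) :
    tClosure (toFrac I) = 1 ↔ tIdeal I = ⊤ := by
  rw [tClosure_toFrac hI, ← FractionalIdeal.coeIdeal_top, FractionalIdeal.coeIdeal_inj]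

theorem isTComaximal_iff {I J : Ideal R} (hI : I ≠ ⊥) :
    IsTComaximal I J ↔ tIdeal (I ⊔ J) = ⊤ :=
  tClosure_toFrac_eq_one_iff fun h => hI (le_bot_iff.1 (le_sup_left.trans h.le))

/-- The fractional ideal b⁻¹H stands for an inverse, so that t-invertibility can be tested with
integral ideals only. -/
theorem isTInvertible_iff {I : Ideal R} : IsTInvertible I ↔
    I ≠ ⊥ ∧ ∃ (H : Ideal R) (b : R), b ≠ 0 ∧ I * H ≤ Ideal.span {b} ∧ b ∈ tIdeal (I * H) := by
  refine and_congr_right fun hI => ?_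
  have hle : toFrac I * (1 / toFrac I) ≤ 1 := by
    rw [mul_comm]
    refine FractionalIdeal.mul_le.2 fun x hx y hy => ?_
    exact (FractionalIdeal.mem_div_iff_of_ne_zero (by simpa using hI)).1 hx y hy
  -- T is the integral ideal I·I⁻¹.
  obtain ⟨T, hT⟩ := FractionalIdeal.le_one_iff_exists_coeIdeal.1 hle
  have hT0 : T ≠ ⊥ := by
    rintro rfl
    obtain ⟨a, ha, ha0⟩ := Submodule.exists_mem_ne_zero_of_ne_bot hI
    have h1 : algebraMap R (FractionRing R) 1 / algebraMap R (FractionRing R) 1 ∈ 1 / toFrac I :=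
      (mem_one_div_toFrac hI one_ne_zero).2 fun j _ => one_dvd _
    have := FractionalIdeal.mul_mem_mul (FractionalIdeal.mem_coeIdeal_of_mem R⁰ ha) h1
    rw [← hT] at this
    exact ha0 (by simpa using this)
  rw [← hT, tClosure_toFrac_eq_one_iff hT0, Ideal.eq_top_iff_one]
  constructor
  · intro h1
    -- Here b is a denominator of I⁻¹ and H = bI⁻¹.
    obtain ⟨b, H, hb, hH⟩ := FractionalIdeal.exists_eq_spanSingleton_mul (1 / toFrac I)
    have hb' : algebraMap R (FractionRing R) b ≠ 0 := by simpa using hb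
    have hIH : I * H = Ideal.span {b} * T := by
      apply FractionalIdeal.coeIdeal_injective (K := FractionRing R)
      change toFrac (I * H) = toFrac (Ideal.span {b} * T)
      rw [toFrac, toFrac, FractionalIdeal.coeIdeal_mul, FractionalIdeal.coeIdeal_mul, hT, hH,
        FractionalIdeal.coeIdeal_span_singleton, mul_left_comm (toFrac I), ← mul_assoc,
        FractionalIdeal.spanSingleton_mul_spanSingleton, mul_inv_cancel₀ hb',
        FractionalIdeal.spanSingleton_one, one_mul]
    refine ⟨H, b, hb, hIH ▸ Ideal.mul_le_left, ?_⟩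
    rw [hIH]
    simpa using (mul_mem_tIdeal_span_mul_iff hb).2 h1
  · rintro ⟨H, b, hb, hIH, hbt⟩
    -- From IH ⊆ bR each h/b lies in I⁻¹, so IH ⊆ b·I·I⁻¹.
    have hle : I * H ≤ Ideal.span {b} * T := by
      refine Ideal.mul_le.2 fun i hi h hh => ?_
      obtain ⟨z, hz⟩ := Ideal.mem_span_singleton.1 (hIH (Ideal.mul_mem_mul hi hh))
      rw [hz]
      refine Ideal.mul_mem_mul (Ideal.mem_span_singleton_self b) ?_
      suffices hz' : algebraMap R (FractionRing R) z ∈ toFrac T by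
        obtain ⟨w, hw, hwz⟩ := (FractionalIdeal.mem_coeIdeal _).1 hz'
        rwa [← IsFractionRing.injective R (FractionRing R) hwz]
      rw [toFrac, hT]
      have hb' : algebraMap R (FractionRing R) b ≠ 0 := by simpa using hb
      have : algebraMap R (FractionRing R) z = algebraMap R (FractionRing R) i *
          (algebraMap R (FractionRing R) h / algebraMap R (FractionRing R) b) := by
        rw [← mul_div_assoc, eq_div_iff hb', ← map_mul, ← map_mul, hz, mul_comm]
      rw [this]
      refine FractionalIdeal.mul_mem_mul (FractionalIdeal.mem_coeIdeal_of_mem _ hi)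
        ((mem_one_div_toFrac hI hb).2 fun j hj => ?_)
      rw [mul_comm]
      exact Ideal.mem_span_singleton.1 (hIH (Ideal.mul_mem_mul hj hh))
    have := tIdeal_mono hle hbt
    rw [← mul_one b] at this
    exact (mul_mem_tIdeal_span_mul_iff hb).1 (by simpa using this)

end Bridge

/-! ### Uniqueness of packet factorizations, and reduction to existence. -/

section Uniqueness

theorem existsUnique_minimalPrimes_iff {R : Type*} [CommRing R] {I : Ideal R} :
    (∃! P : Ideal R, P ∈ I.minimalPrimes) ↔ I.radical.IsPrime := by
  constructor
  · rintro ⟨P, hP, hu⟩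
    have : I.minimalPrimes = {P} := Set.eq_singleton_iff_unique_mem.2 ⟨hP, hu⟩
    rw [← Ideal.sInf_minimalPrimes, this, sInf_singleton]
    exact hP.1.1
  · intro h
    refine ⟨I.radical, ⟨⟨h, Ideal.le_radical⟩, fun Q hQ _ => hQ.1.radical_le_iff.2 hQ.2⟩, ?_⟩
    intro Q hQ
    have hle := hQ.1.1.radical_le_iff.2 hQ.1.2
    exact le_antisymm (hQ.2 ⟨h, Ideal.le_radical⟩ hle) hle

theorem prod_le_of_mem {R : Type*} [CommRing R] {X : Ideal R} {s : Multiset (Ideal R)}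
    (h : X ∈ s) : s.prod ≤ X := by
  obtain ⟨u, rfl⟩ := Multiset.exists_cons_of_mem h
  rw [Multiset.prod_cons]
  exact Ideal.mul_le_left

variable {R : Type*} [CommRing R] [IsDomain R]

theorem isPacket_iff {I : Ideal R} :
    IsPacket I ↔ IsTInvertible I ∧ tIdeal I = I ∧ I.radical.IsPrime := by
  rw [IsPacket, isTIdeal_iff, existsUnique_minimalPrimes_iff]
  exact ⟨fun h => ⟨h.1, h.2.1.2, h.2.2⟩, fun h => ⟨h.1, ⟨h.1.1, h.2.1⟩, h.2.2⟩⟩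

theorem IsPacket.ne_bot {I : Ideal R} (h : IsPacket I) : I ≠ ⊥ := h.1.1

theorem IsPacket.tIdeal_eq {I : Ideal R} (h : IsPacket I) : tIdeal I = I := (isPacket_iff.1 h).2.1

theorem IsPacket.radical_isPrime {I : Ideal R} (h : IsPacket I) : I.radical.IsPrime :=
  (isPacket_iff.1 h).2.2

theorem IsPacket.ne_top {I : Ideal R} (h : IsPacket I) : I ≠ ⊤ := by
  rintro rfl
  exact h.radical_isPrime.ne_top (Ideal.radical_top R)

theorem IsPacket.isTComaximal_iff {X Y : Ideal R} (h : IsPacket X) :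
    IsTComaximal X Y ↔ tIdeal (X ⊔ Y) = ⊤ :=
  URD.isTComaximal_iff h.ne_bot

instance : Std.Symm (IsTComaximal (R := R)) where
  symm X Y h := by rwa [IsTComaximal, sup_comm]

theorem prod_ne_bot {s : Multiset (Ideal R)} (h : ∀ X ∈ s, X ≠ ⊥) : s.prod ≠ ⊥ :=
  Multiset.prod_ne_zero (M₀ := Ideal R) fun h0 => h _ h0 rfl

theorem isPacketFactorization_iff {I : Ideal R} {s : Multiset (Ideal R)} :
    IsPacketFactorization I s ↔
      (∀ X ∈ s, IsPacket X) ∧ s.Pairwise IsTComaximal ∧ I = tIdeal s.prod := by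
  refine and_congr_right fun hs => and_congr_right fun _ => ?_
  rw [tClosure_toFrac (prod_ne_bot fun X hX => (hs X hX).ne_bot), FractionalIdeal.coeIdeal_inj]

theorem pairwise_cons {X : Ideal R} {s : Multiset (Ideal R)} :
    (X ::ₘ s).Pairwise IsTComaximal ↔
      (∀ Y ∈ s, IsTComaximal X Y) ∧ s.Pairwise IsTComaximal := by
  induction s using Quotient.inductionOn with
  | h l =>
    rw [Multiset.quot_mk_to_coe, Multiset.cons_coe, Multiset.pairwise_coe_iff_pairwise,
      Multiset.pairwise_coe_iff_pairwise, List.pairwise_cons]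
    rfl

theorem IsPacketFactorization.le {I X : Ideal R} {s : Multiset (Ideal R)}
    (h : IsPacketFactorization I s) (hX : X ∈ s) : I ≤ X := by
  rw [isPacketFactorization_iff] at h
  rw [h.2.2, ← (h.1 X hX).tIdeal_eq]
  exact tIdeal_mono (prod_le_of_mem hX)

/-- X + Y would lie in rad X, and t-comaximality would force X = X_t = R. -/
theorem not_isTComaximal_of_le_radical {X Y : Ideal R} (hX : IsPacket X) (h : Y ≤ X.radical) :
    ¬ IsTComaximal X Y := fun hc =>
  hX.ne_top (hX.tIdeal_eq ▸ tIdeal_eq_top_of_le_radical (hX.isTComaximal_iff.1 hc)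
    (sup_le Ideal.le_radical h))

theorem IsPacketFactorization.exists_le_radical {I X : Ideal R} {s s' : Multiset (Ideal R)}
    (h : IsPacketFactorization I s) (h' : IsPacketFactorization I s') (hX : X ∈ s) :
    ∃ Y ∈ s', Y ≤ X.radical := by
  have hle : s'.prod ≤ X.radical := by
    refine le_trans ?_ ((h.le hX).trans Ideal.le_radical)
    rw [(isPacketFactorization_iff.1 h').2.2]
    exact le_tIdeal _
  exact (Ideal.IsPrime.multiset_prod_le (h.1 X hX).radical_isPrime).1 hle

theorem IsPacketFactorization.eq_of_mem {I X X' : Ideal R} {s : Multiset (Ideal R)}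
    (h : IsPacketFactorization I s) (hX : X ∈ s) (hX' : X' ∈ s) (hr : X' ≤ X.radical) :
    X' = X := by
  obtain ⟨u, rfl⟩ := Multiset.exists_cons_of_mem hX
  rcases Multiset.mem_cons.1 hX' with h1 | h1
  · exact h1
  · exact absurd ((pairwise_cons.1 h.2.1).1 _ h1) (not_isTComaximal_of_le_radical (h.1 X hX) hr)

/-- Having the radical of Y, the packet X is t-comaximal to the product U of the other factors in
s'. Then Y ⊆ (Y(X + U))_t ⊆ X, since YU ⊆ I ⊆ X. -/
theorem IsPacketFactorization.le_of_radical_eq {I X Y : Ideal R} {s s' : Multiset (Ideal R)}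
    (h : IsPacketFactorization I s) (h' : IsPacketFactorization I s') (hX : X ∈ s) (hY : Y ∈ s')
    (hr : X.radical = Y.radical) : Y ≤ X := by
  have hX' := h.1 X hX
  have hIX := h.le hX
  obtain ⟨u, rfl⟩ := Multiset.exists_cons_of_mem hY
  have hu : tIdeal (X ⊔ u.prod) = ⊤ := tIdeal_sup_multiset_prod fun Z hZ => by
    have hYZ := (h'.1 Y hY).isTComaximal_iff.1 ((pairwise_cons.1 h'.2.1).1 Z hZ)
    refine tIdeal_eq_top_of_le_radical hYZ (sup_le ?_ (le_sup_right.trans Ideal.le_radical))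
    exact Ideal.le_radical.trans (hr ▸ Ideal.radical_mono le_sup_left)
  have hI : Y * u.prod ≤ X := by
    refine le_trans ?_ hIX
    rw [(isPacketFactorization_iff.1 h').2.2, Multiset.prod_cons]
    exact le_tIdeal _
  intro y hy
  have h1 : (1 : R) ∈ tIdeal (X ⊔ u.prod) := hu ▸ Submodule.mem_top
  have h2 := mul_mem_tIdeal (le_tIdeal _ hy) h1
  rw [mul_one] at h2
  rw [← hX'.tIdeal_eq]
  refine tIdeal_mono ?_ h2
  rw [Ideal.mul_sup]
  exact sup_le Ideal.mul_le_right hI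

/-- Going from X to some Y ⊆ rad X in s' and back to some X' ⊆ rad Y in s gives X' ⊆ rad X, so X' =
X by t-comaximality and the radicals of X and Y agree. -/
theorem IsPacketFactorization.subset {I : Ideal R} {s s' : Multiset (Ideal R)}
    (h : IsPacketFactorization I s) (h' : IsPacketFactorization I s') : s ⊆ s' := by
  intro X hX
  obtain ⟨Y, hY, hYX⟩ := h.exists_le_radical h' hX
  obtain ⟨X', hX', hX'Y⟩ := h'.exists_le_radical h hY
  have hYX' := Ideal.radical_le_radical_iff.2 hYX
  have hX'Y' := Ideal.radical_le_radical_iff.2 hX'Y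
  obtain rfl := h.eq_of_mem hX hX' (hX'Y.trans hYX')
  have hr := le_antisymm hX'Y' hYX'
  rwa [le_antisymm (h'.le_of_radical_eq h hY hX hr.symm) (h.le_of_radical_eq h' hX hY hr)]

theorem IsPacketFactorization.nodup {I : Ideal R} {s : Multiset (Ideal R)}
    (h : IsPacketFactorization I s) : s.Nodup := by
  rw [Multiset.nodup_iff_ne_cons_cons]
  rintro X u rfl
  exact not_isTComaximal_of_le_radical (h.1 X (Multiset.mem_cons_self _ _)) Ideal.le_radical
    ((pairwise_cons.1 h.2.1).1 X (Multiset.mem_cons_self _ _))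

theorem IsPacketFactorization.unique {I : Ideal R} {s s' : Multiset (Ideal R)}
    (h : IsPacketFactorization I s) (h' : IsPacketFactorization I s') : s = s' :=
  le_antisymm ((Multiset.le_iff_subset h.nodup).2 (h.subset h'))
    ((Multiset.le_iff_subset h'.nodup).2 (h'.subset h))

/-- `I` is a `t`-product of finitely many mutually `t`-comaximal packets. -/
def HasPacketFactorization (I : Ideal R) : Prop := ∃ s, IsPacketFactorization I s

theorem hasPacketFactorization_top : HasPacketFactorization (⊤ : Ideal R) :=
  ⟨0, isPacketFactorization_iff.2 ⟨by simp, Multiset.pairwise_zero _, by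
    rw [Multiset.prod_zero, Ideal.one_eq_top, tIdeal_top]⟩⟩

theorem IsPacket.hasPacketFactorization {I : Ideal R} (h : IsPacket I) :
    HasPacketFactorization I :=
  ⟨{I}, isPacketFactorization_iff.2 ⟨by simpa using h, ⟨[I], rfl, by simp⟩, by
    rw [Multiset.prod_singleton, h.tIdeal_eq]⟩⟩

theorem pairwise_add {s u : Multiset (Ideal R)} (hs : s.Pairwise IsTComaximal)
    (hu : u.Pairwise IsTComaximal) (h : ∀ X ∈ s, ∀ Y ∈ u, IsTComaximal X Y) :
    (s + u).Pairwise IsTComaximal := by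
  induction s using Multiset.induction_on with
  | empty => simpa using hu
  | cons X s ih =>
    rw [Multiset.cons_add]
    rw [pairwise_cons] at hs ⊢
    refine ⟨fun Y hY => ?_, ih hs.2 fun Z hZ => h Z (Multiset.mem_cons_of_mem hZ)⟩
    rcases Multiset.mem_add.1 hY with hY | hY
    · exact hs.1 Y hY
    · exact h X (Multiset.mem_cons_self _ _) Y hY

/-- Factors of I contain I and factors of J contain J, so comaximality of I and J passes to every
mixed pair. -/
theorem HasPacketFactorization.mul {I J : Ideal R} (hI : HasPacketFactorization I)
    (hJ : HasPacketFactorization J) (hc : I ⊔ J = ⊤) (ht : tIdeal (I * J) = I * J) :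
    HasPacketFactorization (I * J) := by
  obtain ⟨s, hs⟩ := hI
  obtain ⟨u, hu⟩ := hJ
  refine ⟨s + u, isPacketFactorization_iff.2 ⟨fun X hX => ?_, ?_, ?_⟩⟩
  · rcases Multiset.mem_add.1 hX with hX | hX
    · exact hs.1 X hX
    · exact hu.1 X hX
  · refine pairwise_add hs.2.1 hu.2.1 fun X hX Y hY => ?_
    rw [(hs.1 X hX).isTComaximal_iff,
      top_le_iff.1 (hc.ge.trans (sup_le_sup (hs.le hX) (hu.le hY))), tIdeal_top]
  · rw [← ht, Multiset.prod_add, ← tIdeal_mul_tIdeal s.prod,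
      ← (isPacketFactorization_iff.1 hs).2.2, ← (isPacketFactorization_iff.1 hu).2.2]

theorem isURD_iff : IsURD R ↔ ∀ I : Ideal R, IsTInvertible I → tIdeal I = I →
    HasPacketFactorization I := by
  constructor
  · intro h I hI ht
    by_cases hI' : I = ⊤
    · exact hI' ▸ hasPacketFactorization_top
    · exact (h I hI' hI (isTIdeal_iff.2 ⟨hI.1, ht⟩)).exists
  · intro h I _ hI ht
    obtain ⟨s, hs⟩ := h I hI (isTIdeal_iff.1 ht).2
    exact ⟨s, hs, fun u hu => hu.unique hs⟩

end Uniqueness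

/-! ### Principal ideals and cancellation of principal factors. -/

section Principal

variable {R : Type*} [CommRing R] [IsDomain R]

theorem tIdeal_span_singleton {c : R} (hc : c ≠ 0) : tIdeal (Ideal.span {c}) = Ideal.span {c} := by
  simpa [tIdeal_top] using span_mul_tIdeal hc (⊤ : Ideal R)

theorem isTInvertible_span_singleton {c : R} (hc : c ≠ 0) : IsTInvertible (Ideal.span {c}) :=
  isTInvertible_iff.2 ⟨by simpa using hc, ⊤, c, hc, by simp, by
    simpa using le_tIdeal _ (Ideal.mem_span_singleton_self c)⟩

theorem tIdeal_eq_of_span_mul {c : R} (hc : c ≠ 0) {I : Ideal R}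
    (h : tIdeal (Ideal.span {c} * I) = Ideal.span {c} * I) : tIdeal I = I := by
  rw [span_mul_tIdeal hc] at h
  ext x
  have := congrArg (c * x ∈ ·) h
  simp only [Ideal.mem_span_singleton_mul, mul_right_inj' hc, exists_eq_right, eq_iff_iff] at this
  exact this

theorem isTInvertible_of_span_mul {c : R} {I : Ideal R}
    (h : IsTInvertible (Ideal.span {c} * I)) : IsTInvertible I := by
  rw [isTInvertible_iff] at h ⊢
  obtain ⟨h0, H, b, hb, hle, hbt⟩ := h
  refine ⟨by rintro rfl; simp at h0, Ideal.span {c} * H, b, hb, ?_, ?_⟩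
  · rwa [mul_left_comm, ← mul_assoc]
  · rwa [mul_left_comm, ← mul_assoc]

end Principal

/-! ### The constant-term retraction and the ideals J + XK[X]. -/

section Composite

variable (D : Type*) [CommRing D] [IsDomain D] (K : Type*) [Field K] [Algebra D K]
    [IsFractionRing D K]

/-- The constant coefficient, as a ring homomorphism `D + X K[X] → D`. -/
noncomputable def constTerm : compositeRing D K →+* D where
  toFun f := Classical.choose f.2
  map_one' := IsFractionRing.injective D K (by
    rw [Classical.choose_spec (1 : compositeRing D K).2]; simp)
  map_zero' := IsFractionRing.injective D K (by
    rw [Classical.choose_spec (0 : compositeRing D K).2]; simp)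
  map_add' f g := IsFractionRing.injective D K (by
    rw [map_add, Classical.choose_spec (f + g).2, Classical.choose_spec f.2,
      Classical.choose_spec g.2]; simp)
  map_mul' f g := IsFractionRing.injective D K (by
    rw [map_mul, Classical.choose_spec (f * g).2, Classical.choose_spec f.2,
      Classical.choose_spec g.2]; simp)

/-- The constant polynomials, as a ring homomorphism `D → D + X K[X]`. -/
noncomputable def const : D →+* compositeRing D K :=
  (Polynomial.C.comp (algebraMap D K)).codRestrict _ fun d =>
    mem_compositeRing.2 ⟨d, 0, by simp⟩

variable {D K}

theorem algebraMap_constTerm (f : compositeRing D K) :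
    algebraMap D K (constTerm D K f) = (f : K[X]).coeff 0 :=
  Classical.choose_spec f.2

@[simp]
theorem coe_const (d : D) : (const D K d : K[X]) = Polynomial.C (algebraMap D K d) := rfl

@[simp]
theorem constTerm_const (d : D) : constTerm D K (const D K d) = d :=
  IsFractionRing.injective D K (by simp [algebraMap_constTerm])

theorem constTerm_surjective : Function.Surjective (constTerm D K) := fun d =>
  ⟨const D K d, constTerm_const d⟩

variable (D) in
/-- The element `X k` of `D + X K[X]`. -/
noncomputable def xMul (k : K[X]) : compositeRing D K :=
  ⟨Polynomial.X * k, mem_compositeRing.2 ⟨0, k, by simp⟩⟩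

@[simp]
theorem coe_xMul (k : K[X]) : (xMul D k : K[X]) = Polynomial.X * k := rfl

@[simp]
theorem constTerm_xMul (k : K[X]) : constTerm D K (xMul D k) = 0 :=
  IsFractionRing.injective D K (by simp [algebraMap_constTerm])

theorem exists_eq_const_add_xMul (f : compositeRing D K) :
    ∃ k : K[X], f = const D K (constTerm D K f) + xMul D k := by
  refine ⟨(f : K[X]).divX, Subtype.ext ?_⟩
  rw [Subring.coe_add, coe_const, coe_xMul, algebraMap_constTerm, add_comm]
  exact (Polynomial.X_mul_divX_add _).symm

theorem exists_eq_xMul {f : compositeRing D K} (hf : constTerm D K f = 0) :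
    ∃ k : K[X], f = xMul D k := by
  obtain ⟨k, hk⟩ := exists_eq_const_add_xMul f
  exact ⟨k, by rw [hk, hf]; simp⟩

theorem dvd_of_coeff_zero {a b : compositeRing D K} {k : K[X]} (h : (a : K[X]) = b * k) {d : D}
    (hd : algebraMap D K d = k.coeff 0) : b ∣ a :=
  ⟨⟨k, ⟨d, by simpa using hd⟩⟩, Subtype.ext h⟩

theorem xMul_mem_of_const_mem {A : Ideal (compositeRing D K)} {d : D} (hd : d ≠ 0)
    (h : const D K d ∈ A) (k : K[X]) : xMul D k ∈ A := by
  have hd' : algebraMap D K d ≠ 0 := by simpa using hd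
  have : xMul D k = const D K d * xMul D (Polynomial.C (algebraMap D K d)⁻¹ * k) := by
    refine Subtype.ext ?_
    rw [Subring.coe_mul, coe_const, coe_xMul, coe_xMul, mul_left_comm, ← mul_assoc (Polynomial.C _),
      ← Polynomial.C_mul, mul_inv_cancel₀ hd', Polynomial.C_1, one_mul]
  rw [this]
  exact A.mul_mem_right _ h

/-- A nonzero constant in an ideal brings in all of XK[X]. Extension handles products and finite
generation, contraction handles radicals and primes. -/
theorem comap_constTerm_eq_map {J : Ideal D} (hJ : J ≠ ⊥) :
    J.comap (constTerm D K) = J.map (const D K) := by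
  apply le_antisymm
  · intro f hf
    obtain ⟨k, hk⟩ := exists_eq_const_add_xMul f
    obtain ⟨d, hd, hd0⟩ := Submodule.exists_mem_ne_zero_of_ne_bot hJ
    rw [hk]
    exact add_mem (Ideal.mem_map_of_mem _ hf)
      (xMul_mem_of_const_mem hd0 (Ideal.mem_map_of_mem _ hd) k)
  · rw [Ideal.map_le_iff_le_comap]
    intro d hd
    simpa using hd

theorem comap_constTerm_ne_bot {J : Ideal D} (hJ : J ≠ ⊥) : J.comap (constTerm D K) ≠ ⊥ := by
  obtain ⟨d, hd, hd0⟩ := Submodule.exists_mem_ne_zero_of_ne_bot hJ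
  intro h
  have : const D K d ∈ J.comap (constTerm D K) := by simpa using hd
  rw [h, Ideal.mem_bot] at this
  exact hd0 (by simpa using congrArg (constTerm D K) this)

theorem comap_constTerm_mul {I J : Ideal D} (hI : I ≠ ⊥) (hJ : J ≠ ⊥) :
    (I * J).comap (constTerm D K) = I.comap (constTerm D K) * J.comap (constTerm D K) := by
  rw [comap_constTerm_eq_map hI, comap_constTerm_eq_map hJ,
    comap_constTerm_eq_map (mul_ne_zero (M₀ := Ideal D) hI hJ), Ideal.map_mul]

theorem comap_constTerm_sup (I J : Ideal D) :
    (I ⊔ J).comap (constTerm D K) = I.comap (constTerm D K) ⊔ J.comap (constTerm D K) := by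
  apply le_antisymm
  · intro f hf
    obtain ⟨i, hi, j, hj, hij⟩ := Submodule.mem_sup.1 (Ideal.mem_comap.1 hf)
    obtain ⟨k, hk⟩ := exists_eq_const_add_xMul f
    rw [hk, ← hij, map_add, add_assoc]
    exact Submodule.add_mem_sup (by simpa using hi) (by simpa using hj)
  · exact sup_le (Ideal.comap_mono le_sup_left) (Ideal.comap_mono le_sup_right)

theorem vIdeal_comap {J : Ideal D} (hJ : J ≠ ⊥) :
    vIdeal (J.comap (constTerm D K)) = (vIdeal J).comap (constTerm D K) := by
  obtain ⟨c, hc, hc0⟩ := Submodule.exists_mem_ne_zero_of_ne_bot hJ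
  have hc' : algebraMap D K c ≠ 0 := by simpa using hc0
  apply le_antisymm
  · intro x hx p q hq h
    have hq' : const D K q ≠ 0 := fun h0 => hq (by simpa using congrArg (constTerm D K) h0)
    have key : ∀ y ∈ J.comap (constTerm D K), const D K q ∣ const D K p * y := by
      intro y hy
      rw [comap_constTerm_eq_map hJ] at hy
      refine Submodule.span_induction ?_ (by simp) ?_ ?_ hy
      · rintro _ ⟨j, hj, rfl⟩
        rw [← map_mul]
        exact map_dvd _ (h j hj)
      · intro x y _ _ hx hy
        rw [mul_add]
        exact dvd_add hx hy
      · intro a x _ hx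
        rw [smul_eq_mul, mul_left_comm]
        exact hx.mul_left a
    simpa using map_dvd (constTerm D K) (hx (const D K p) (const D K q) hq' key)
  · intro x hx a b hb h
    -- Testing at the nonzero constant c shows that a/b is a polynomial k over K. Then kx ∈ R is
    -- only a condition on constant terms, namely that k(0) = p/q carries x(0) into D.
    have hb' : (b : K[X]) ≠ 0 := fun h0 => hb (Subtype.ext h0)
    obtain ⟨z, hz⟩ := h (const D K c) (by simpa using hc)
    obtain ⟨k, hk⟩ : ∃ k : K[X], (a : K[X]) = b * k := by
      refine ⟨z * Polynomial.C (algebraMap D K c)⁻¹, ?_⟩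
      rw [← mul_assoc, ← Subring.coe_mul, ← hz, Subring.coe_mul, coe_const, mul_assoc,
        ← Polynomial.C_mul, mul_inv_cancel₀ hc', Polynomial.C_1, mul_one]
    obtain ⟨p, q, hq, hpq⟩ := IsFractionRing.div_surjective (A := D) (k.coeff 0)
    have hq : q ≠ 0 := nonZeroDivisors.ne_zero hq
    have hq' : algebraMap D K q ≠ 0 := by simpa using hq
    have h1 : q ∣ p * constTerm D K x := by
      refine hx p q hq fun j hj => ?_
      obtain ⟨w, hw⟩ := h (const D K j) (by simpa using hj)
      have hw' : k * Polynomial.C (algebraMap D K j) = w := by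
        apply mul_left_cancel₀ hb'
        rw [← mul_assoc, ← hk]
        exact congrArg Subtype.val hw
      have := congrArg (fun f => f.coeff 0) hw'
      simp only [Polynomial.mul_coeff_zero, Polynomial.coeff_C_zero, ← algebraMap_constTerm] at this
      refine ⟨constTerm D K w, IsFractionRing.injective D K ?_⟩
      rw [map_mul, map_mul, ← this, ← hpq]
      field_simp
    obtain ⟨d, hd⟩ := h1
    refine dvd_of_coeff_zero (k := k * x) (d := d) ?_ ?_
    · rw [Subring.coe_mul, hk, mul_assoc]
    · rw [Polynomial.mul_coeff_zero, ← hpq, ← algebraMap_constTerm, div_mul_eq_mul_div, ← map_mul,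
        hd, map_mul]
      field_simp

theorem tIdeal_comap {I : Ideal D} (hI : I ≠ ⊥) :
    tIdeal (I.comap (constTerm D K)) = (tIdeal I).comap (constTerm D K) := by
  apply le_antisymm
  · rintro x ⟨A, hA, f, hx⟩
    -- The image of A under the constant term may be zero; adjoining c keeps `vIdeal_comap`
    -- applicable.
    obtain ⟨c, hc, hc0⟩ := Submodule.exists_mem_ne_zero_of_ne_bot hI
    have hJ : A.map (constTerm D K) ⊔ Ideal.span {c} ≠ ⊥ := fun h => hc0 (by
      simpa using (le_sup_right.trans h.le) (Ideal.mem_span_singleton_self c))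
    refine ⟨A.map (constTerm D K) ⊔ Ideal.span {c}, ?_, ?_, ?_⟩
    · exact sup_le (Ideal.map_le_iff_le_comap.2 hA) ((Ideal.span_singleton_le_iff_mem I).2 hc)
    · exact Submodule.FG.sup (Ideal.FG.map f _) (Submodule.fg_span_singleton c)
    · rw [← Ideal.mem_comap, ← vIdeal_comap hJ]
      exact vIdeal_mono ((Ideal.map_le_iff_le_comap.1 le_rfl).trans
        (Ideal.comap_mono le_sup_left)) hx
  · rintro x ⟨J, hJ, f, hx⟩
    obtain ⟨c, hc, hc0⟩ := Submodule.exists_mem_ne_zero_of_ne_bot hI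
    have hJ0 : J ⊔ Ideal.span {c} ≠ ⊥ := fun h => hc0 (by
      simpa using (le_sup_right.trans h.le) (Ideal.mem_span_singleton_self c))
    refine ⟨(J ⊔ Ideal.span {c}).comap (constTerm D K), Ideal.comap_mono
      (sup_le hJ ((Ideal.span_singleton_le_iff_mem I).2 hc)), ?_, ?_⟩
    · rw [comap_constTerm_eq_map hJ0]
      exact Ideal.FG.map (Submodule.FG.sup f (Submodule.fg_span_singleton c)) _
    · rw [vIdeal_comap hJ0]
      exact vIdeal_mono le_sup_left hx

theorem comap_constTerm_injective :
    Function.Injective (Ideal.comap (constTerm D K)) :=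
  Ideal.comap_injective_of_surjective _ constTerm_surjective

theorem tIdeal_comap_eq_iff {I : Ideal D} (hI : I ≠ ⊥) :
    tIdeal (I.comap (constTerm D K)) = I.comap (constTerm D K) ↔ tIdeal I = I := by
  rw [tIdeal_comap hI, comap_constTerm_injective.eq_iff]

/-- Every nonzero constant divides XK[X]. If f(0) ≠ 0, an f in the v-closure would be divisible by
d·f(0), making d a unit. -/
theorem vIdeal_ker {d : D} (hd : d ≠ 0) (hu : ¬ IsUnit d) :
    vIdeal (RingHom.ker (constTerm D K)) ≤ RingHom.ker (constTerm D K) := by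
  intro f hf
  by_contra h0
  rw [RingHom.mem_ker] at h0
  have hb : d * constTerm D K f ≠ 0 := mul_ne_zero hd h0
  have hb' : const D K (d * constTerm D K f) ≠ 0 := fun h =>
    hb (by simpa using congrArg (constTerm D K) h)
  have h1 := map_dvd (constTerm D K) (hf 1 _ hb' fun y hy => by
    obtain ⟨k, rfl⟩ := exists_eq_xMul ((RingHom.mem_ker).1 hy)
    rw [one_mul]
    exact Ideal.mem_span_singleton.1
      (xMul_mem_of_const_mem hb (Ideal.mem_span_singleton_self _) k))
  rw [constTerm_const, one_mul] at h1
  exact hu (isUnit_of_dvd_one ((mul_dvd_mul_iff_right h0).1 (by simpa using h1)))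

theorem isTInvertible_comap {I : Ideal D} (h : IsTInvertible I) :
    IsTInvertible (I.comap (constTerm D K)) := by
  by_cases hI' : I = ⊤
  · rw [hI', Ideal.comap_top, ← Ideal.span_singleton_one]
    exact isTInvertible_span_singleton one_ne_zero
  rw [isTInvertible_iff] at h ⊢
  obtain ⟨hI, H, b, hb, hle, hbt⟩ := h
  -- If H = 0, then b is divisible by every nonzero element, in particular by cb, so c ∈ I is a
  -- unit; the case I = R was set aside for this.
  have hH : H ≠ ⊥ := by
    rintro rfl
    obtain ⟨c, hc, hc0⟩ := Submodule.exists_mem_ne_zero_of_ne_bot hI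
    have h1 := tIdeal_le_vIdeal _ hbt 1 (c * b) (mul_ne_zero hc0 hb) fun j hj => by
      rw [show j = 0 by simpa using hj, mul_zero]
      exact dvd_zero _
    exact hI' (Ideal.eq_top_of_isUnit_mem _ hc
      (isUnit_of_dvd_one ((mul_dvd_mul_iff_right hb).1 h1)))
  refine ⟨comap_constTerm_ne_bot hI, H.comap (constTerm D K), const D K b,
    fun h => hb (by simpa using congrArg (constTerm D K) h), ?_, ?_⟩
  · rw [← comap_constTerm_mul hI hH, comap_constTerm_eq_map (mul_ne_zero (M₀ := Ideal D) hI hH),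
      ← Set.image_singleton, ← Ideal.map_span]
    exact Ideal.map_mono hle
  · rw [← comap_constTerm_mul hI hH, tIdeal_comap (mul_ne_zero (M₀ := Ideal D) hI hH)]
    simpa using hbt

theorem isTInvertible_of_comap {I : Ideal D} (hI : I ≠ ⊥)
    (h : IsTInvertible (I.comap (constTerm D K))) : IsTInvertible I := by
  by_cases hI' : I = ⊤
  · rw [hI', ← Ideal.span_singleton_one]
    exact isTInvertible_span_singleton one_ne_zero
  obtain ⟨c, hc, hc0⟩ := Submodule.exists_mem_ne_zero_of_ne_bot hI
  have hcu : ¬ IsUnit c := fun hu => hI' (Ideal.eq_top_of_isUnit_mem _ hc hu)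
  have hc' : const D K c ≠ 0 := fun h => hc0 (by simpa using congrArg (constTerm D K) h)
  rw [isTInvertible_iff] at h ⊢
  obtain ⟨-, H, b, hb, hle, hbt⟩ := h
  set Î := I.comap (constTerm D K) with hÎ
  have hcI : const D K c ∈ Î := by simpa [hÎ] using hc
  -- The constant term of b may vanish, so H and b cannot be pushed down to D directly. With G =
  -- cb⁻¹H the denominator becomes the nonzero constant c.
  obtain ⟨G, hG⟩ : ∃ G, Ideal.span {const D K c} * H = Ideal.span {b} * G := by
    have hdvd : Ideal.span {const D K c} * H ≤ Ideal.span {b} :=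
      (Ideal.mul_mono_left ((Ideal.span_singleton_le_iff_mem _).2 hcI)).trans hle
    refine ⟨Submodule.comap (LinearMap.mulLeft _ b) (Ideal.span {const D K c} * H),
      le_antisymm ?_ ?_⟩
    · intro y hy
      obtain ⟨z, rfl⟩ := Ideal.mem_span_singleton.1 (hdvd hy)
      exact Ideal.mul_mem_mul (Ideal.mem_span_singleton_self b) hy
    · rw [Ideal.span_singleton_mul_le_iff]
      exact fun z hz => hz
  have hct : const D K c ∈ tIdeal (Î * G) := by
    refine (mul_mem_tIdeal_span_mul_iff hb).1 ?_
    rw [mul_left_comm, ← hG, mul_left_comm, mul_comm b]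
    exact (mul_mem_tIdeal_span_mul_iff hc').2 hbt
  have hIG : Î * G ≤ (I * G.map (constTerm D K)).comap (constTerm D K) := by
    refine Ideal.mul_le.2 fun i hi g hg => ?_
    rw [Ideal.mem_comap, map_mul]
    exact Ideal.mul_mem_mul hi (Ideal.mem_map_of_mem _ hg)
  refine ⟨hI, G.map (constTerm D K), c, hc0, ?_, ?_⟩
  · rw [Ideal.mul_le]
    intro i hi g hg
    obtain ⟨y, hy, rfl⟩ := (Ideal.mem_map_iff_of_surjective _ constTerm_surjective).1 hg
    have hby : b * y ∈ Ideal.span {const D K c} * H :=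
      hG ▸ Ideal.mul_mem_mul (Ideal.mem_span_singleton_self b) hy
    obtain ⟨h, hh, hhy⟩ := Ideal.mem_span_singleton_mul.1 hby
    obtain ⟨z, hz⟩ := Ideal.mem_span_singleton.1
      (hle (Ideal.mul_mem_mul (show const D K i ∈ Î by simpa [hÎ] using hi) hh))
    have : const D K i * y = const D K c * z := by
      apply mul_left_cancel₀ hb
      rw [mul_left_comm, ← hhy, mul_left_comm, hz, mul_left_comm]
    have := congrArg (constTerm D K) this
    rw [map_mul, map_mul, constTerm_const, constTerm_const] at this
    exact Ideal.mem_span_singleton.2 ⟨_, this⟩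
  -- Otherwise ÎG ⊆ XK[X], which is v-closed because c is not a unit, and c would lie in XK[X].
  · have hne : I * G.map (constTerm D K) ≠ ⊥ := by
      intro h0
      rw [h0, ← RingHom.ker_eq_comap_bot] at hIG
      have := vIdeal_ker hc0 hcu (vIdeal_mono hIG (tIdeal_le_vIdeal _ hct))
      rw [RingHom.mem_ker, constTerm_const] at this
      exact hc0 this
    have := tIdeal_mono hIG hct
    rw [tIdeal_comap hne] at this
    simpa using this

theorem comap_isPrime_iff_of_surjective {R S : Type*} [CommRing R] [CommRing S] {f : R →+* S}
    (hf : Function.Surjective f) {P : Ideal S} : (P.comap f).IsPrime ↔ P.IsPrime := by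
  refine ⟨fun h => ⟨?_, fun {x y} hxy => ?_⟩, fun h => h.comap f⟩
  · rintro rfl
    exact h.ne_top Ideal.comap_top
  · obtain ⟨x, rfl⟩ := hf x
    obtain ⟨y, rfl⟩ := hf y
    rw [← map_mul] at hxy
    exact h.mem_or_mem hxy

theorem isPacket_comap_iff {I : Ideal D} (hI : I ≠ ⊥) :
    IsPacket (I.comap (constTerm D K)) ↔ IsPacket I := by
  rw [isPacket_iff, isPacket_iff, tIdeal_comap_eq_iff hI, ← Ideal.comap_radical,
    comap_isPrime_iff_of_surjective constTerm_surjective]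
  exact and_congr_left fun _ => ⟨isTInvertible_of_comap hI, isTInvertible_comap⟩

theorem isTComaximal_comap_iff {I J : Ideal D} (hI : I ≠ ⊥) :
    IsTComaximal (I.comap (constTerm D K)) (J.comap (constTerm D K)) ↔ IsTComaximal I J := by
  rw [isTComaximal_iff hI, isTComaximal_iff (comap_constTerm_ne_bot hI), ← comap_constTerm_sup,
    tIdeal_comap fun h => hI (le_bot_iff.1 (le_sup_left.trans h.le)),
    ← Ideal.comap_top (f := constTerm D K), comap_constTerm_injective.eq_iff]

end Composite

/-! ### Packet factorizations over D and over D + XK[X]. -/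

section Transfer

variable {D : Type*} [CommRing D] [IsDomain D] {K : Type*} [Field K] [Algebra D K]
    [IsFractionRing D K]

theorem comap_multiset_prod {s : Multiset (Ideal D)} (h : ∀ X ∈ s, X ≠ ⊥) :
    s.prod.comap (constTerm D K) = (s.map (Ideal.comap (constTerm D K))).prod := by
  induction s using Multiset.induction_on with
  | empty => simp [Ideal.one_eq_top, Ideal.comap_top]
  | cons X s ih =>
    have hs : ∀ Y ∈ s, Y ≠ ⊥ := fun Y hY => h Y (Multiset.mem_cons_of_mem hY)
    rw [Multiset.prod_cons, Multiset.map_cons, Multiset.prod_cons, ← ih hs,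
      comap_constTerm_mul (h X (Multiset.mem_cons_self _ _)) (prod_ne_bot hs)]

theorem pairwise_comap_iff {s : Multiset (Ideal D)} (h : ∀ X ∈ s, X ≠ ⊥) :
    (s.map (Ideal.comap (constTerm D K))).Pairwise IsTComaximal ↔ s.Pairwise IsTComaximal := by
  induction s using Multiset.induction_on with
  | empty => simp
  | cons X s ih =>
    rw [Multiset.map_cons, pairwise_cons, pairwise_cons,
      ih fun Y hY => h Y (Multiset.mem_cons_of_mem hY), Multiset.forall_mem_map_iff]
    simp only [isTComaximal_comap_iff (h X (Multiset.mem_cons_self _ _))]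

theorem isPacketFactorization_comap_iff {I : Ideal D} {s : Multiset (Ideal D)}
    (h : ∀ X ∈ s, X ≠ ⊥) :
    IsPacketFactorization (I.comap (constTerm D K)) (s.map (Ideal.comap (constTerm D K))) ↔
      IsPacketFactorization I s := by
  rw [isPacketFactorization_iff, isPacketFactorization_iff, pairwise_comap_iff h,
    ← comap_multiset_prod h, tIdeal_comap (prod_ne_bot h), comap_constTerm_injective.eq_iff,
    Multiset.forall_mem_map_iff]
  exact and_congr_left fun _ => forall₂_congr fun X hX => isPacket_comap_iff (h X hX)

theorem hasPacketFactorization_comap_iff {I : Ideal D} (hI : I ≠ ⊥) :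
    HasPacketFactorization (I.comap (constTerm D K)) ↔ HasPacketFactorization I := by
  constructor
  · rintro ⟨s, hs⟩
    -- Each factor contains the pulled-back ideal, hence XK[X], so it is itself pulled back from D.
    have hX : ∀ X ∈ s, (X.map (constTerm D K)).comap (constTerm D K) = X := by
      intro X hX
      rw [Ideal.comap_map_of_surjective' _ constTerm_surjective, sup_eq_left,
        RingHom.ker_eq_comap_bot]
      exact (Ideal.comap_mono bot_le).trans (hs.le hX)
    refine ⟨s.map (Ideal.map (constTerm D K)), ?_⟩
    rw [← isPacketFactorization_comap_iff (K := K), Multiset.map_map]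
    · convert hs
      exact (Multiset.map_congr rfl hX).trans (Multiset.map_id' s)
    · rw [Multiset.forall_mem_map_iff]
      intro X hXs h0
      refine hI (le_bot_iff.1 ?_)
      rw [← h0, ← Ideal.map_comap_of_surjective _ (constTerm_surjective (K := K)) I]
      exact Ideal.map_mono (hs.le hXs)
  · rintro ⟨s, hs⟩
    exact ⟨_, (isPacketFactorization_comap_iff fun X hX => (hs.1 X hX).ne_bot).2 hs⟩

theorem isURD_of_compositeRing (h : IsURD (compositeRing D K)) : IsURD D := by
  rw [isURD_iff] at h ⊢
  intro I hI ht
  rw [← hasPacketFactorization_comap_iff (K := K) hI.1]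
  exact h _ (isTInvertible_comap hI) ((tIdeal_comap_eq_iff hI.1).2 ht)

end Transfer

/-! ### Splitting an ideal of D + XK[X] as hB, and factoring both parts. -/

section Decomposition

variable {D : Type*} [CommRing D] [IsDomain D] {K : Type*} [Field K] [Algebra D K]
    [IsFractionRing D K]

theorem exists_coe_eq_of_coeff_zero {f : K[X]} {d : D} (h : f.coeff 0 = algebraMap D K d) :
    ∃ g : compositeRing D K, (g : K[X]) = f ∧ constTerm D K g = d :=
  ⟨⟨f, ⟨d, by simpa using h.symm⟩⟩, rfl, IsFractionRing.injective D K (by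
    rw [algebraMap_constTerm]; exact h)⟩

theorem ne_zero_of_constTerm_eq_one {g : compositeRing D K} (hg : constTerm D K g = 1) :
    g ≠ 0 := by
  rintro rfl
  simp at hg

theorem coeff_zero_of_constTerm_eq_one {g : compositeRing D K} (hg : constTerm D K g = 1) :
    (g : K[X]).coeff 0 = 1 := by
  rw [← algebraMap_constTerm, hg, map_one]

/-- The quotient in K[X] has constant term f(0), already in D. Thus primes of K[X] with constant
term 1 stay prime in R. -/
theorem dvd_iff_of_constTerm_eq_one {g f : compositeRing D K} (hg : constTerm D K g = 1) :
    g ∣ f ↔ (g : K[X]) ∣ f := by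
  refine ⟨fun h => map_dvd (compositeRing D K).subtype h, ?_⟩
  rintro ⟨k, hk⟩
  refine dvd_of_coeff_zero hk (d := constTerm D K f) ?_
  rw [algebraMap_constTerm, hk, Polynomial.mul_coeff_zero, coeff_zero_of_constTerm_eq_one hg,
    one_mul]

theorem isPacket_span_pow {p : compositeRing D K} (hp1 : constTerm D K p = 1)
    (hp : Prime (p : K[X])) {n : ℕ} (hn : n ≠ 0) : IsPacket (Ideal.span {p ^ n}) := by
  have hp0 := ne_zero_of_constTerm_eq_one hp1
  have hpn : p ^ n ≠ 0 := pow_ne_zero n hp0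
  have hprime : (Ideal.span {p}).IsPrime := by
    rw [Ideal.span_singleton_prime hp0]
    refine ⟨hp0, fun hu => hp.not_isUnit (hu.map (compositeRing D K).subtype), fun a b hab => ?_⟩
    rw [dvd_iff_of_constTerm_eq_one hp1] at *
    rw [dvd_iff_of_constTerm_eq_one hp1]
    exact hp.dvd_or_dvd hab
  refine isPacket_iff.2 ⟨isTInvertible_span_singleton hpn, tIdeal_span_singleton hpn, ?_⟩
  rwa [← Ideal.span_singleton_pow, Ideal.radical_pow _ hn, hprime.radical]

/-- Multiplying a Bézout relation of K[X] by Xk brings its coefficients into R. The sum therefore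
contains XK[X], modulo which f is 1. -/
theorem span_sup_span_eq_top {f g : compositeRing D K} (hf : constTerm D K f = 1)
    (h : IsCoprime (f : K[X]) g) : Ideal.span {f} ⊔ Ideal.span {g} = ⊤ := by
  have hx : ∀ k, xMul D k ∈ Ideal.span {f} ⊔ Ideal.span {g} := by
    intro k
    obtain ⟨u, v, huv⟩ := h
    have : xMul D k = f * xMul D (u * k) + g * xMul D (v * k) := by
      refine Subtype.ext ?_
      simp only [Subring.coe_add, Subring.coe_mul, coe_xMul]
      linear_combination -Polynomial.X * k * huv
    rw [this]
    exact Submodule.add_mem_sup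
      (Ideal.mul_mem_right _ _ (Ideal.mem_span_singleton_self f))
      (Ideal.mul_mem_right _ _ (Ideal.mem_span_singleton_self g))
  obtain ⟨k, hk⟩ := exists_eq_const_add_xMul f
  rw [hf, map_one] at hk
  rw [Ideal.eq_top_iff_one, show (1 : compositeRing D K) = f - xMul D k by rw [hk]; ring]
  exact sub_mem (Ideal.mem_sup_left (Ideal.mem_span_singleton_self f)) (hx k)

theorem hasPacketFactorization_span {g : compositeRing D K} (hg : constTerm D K g = 1) :
    HasPacketFactorization (Ideal.span {g}) := by
  -- Induction over K[X] leaves the polynomials with constant term 1; u = f(0)⁻¹ renormalizes, and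
  -- its existence excludes the prime X.
  have key : ∀ f : K[X], ∀ u : K, u * f.coeff 0 = 1 → ∀ g : compositeRing D K,
      (g : K[X]) = Polynomial.C u * f → HasPacketFactorization (Ideal.span {g}) := by
    intro f
    have hone : ∀ {f : K[X]} {u : K}, u * f.coeff 0 = 1 →
        ∃ g : compositeRing D K, (g : K[X]) = Polynomial.C u * f ∧ constTerm D K g = 1 :=
      fun h => exists_coe_eq_of_coeff_zero (by simpa using h)
    have hinj : Function.Injective (Subtype.val : compositeRing D K → K[X]) :=
      Subtype.val_injective
    induction f using UniqueFactorizationMonoid.induction_on_coprime with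
    | h0 =>
      intro u hu
      simp at hu
    | @h1 x hx =>
      intro u hu g hg
      obtain ⟨g', hg', hg1⟩ := hone hu
      obtain rfl := hinj (hg.trans hg'.symm)
      have : IsUnit g := by
        refine isUnit_of_dvd_one ((dvd_iff_of_constTerm_eq_one hg1).2 ?_)
        rw [hg]
        have hu' : IsUnit (Polynomial.C u) :=
          Polynomial.isUnit_C.2 (IsUnit.of_mul_eq_one _ hu)
        exact (hu'.mul hx).dvd
      rw [Ideal.span_singleton_eq_top.2 this]
      exact hasPacketFactorization_top
    | @hpr p i hp =>
      intro u hu g hg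
      by_cases hi : i = 0
      · subst hi
        have : u = 1 := by simpa using hu
        have : g = 1 := hinj (by rw [hg, this]; simp)
        rw [this, Ideal.span_singleton_one]
        exact hasPacketFactorization_top
      have hc : (p.coeff 0) ^ i = (p ^ i).coeff 0 := by
        simp only [← Polynomial.constantCoeff_apply, map_pow]
      have hp0 : p.coeff 0 ≠ 0 := by
        intro h0
        rw [← hc, h0, zero_pow hi, mul_zero] at hu
        exact zero_ne_one hu
      obtain ⟨q, hq, hq1⟩ := hone (inv_mul_cancel₀ hp0)
      have hqp : Prime (q : K[X]) := by
        rw [hq]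
        refine (Associated.prime_iff ?_).1 hp
        exact (associated_unit_mul_left _ _
          (Polynomial.isUnit_C.2 (inv_ne_zero hp0).isUnit)).symm
      have : g = q ^ i := hinj (by
        change (g : K[X]) = (q : K[X]) ^ i
        rw [hg, hq, mul_pow, ← Polynomial.C_pow, inv_pow, hc, eq_inv_of_mul_eq_one_left hu])
      rw [this]
      exact (isPacket_span_pow hq1 hqp hi).hasPacketFactorization
    | @hcp x y hxy hx hy =>
      intro u hu g hg
      rw [Polynomial.mul_coeff_zero] at hu
      have hx0 : x.coeff 0 ≠ 0 := by rintro h; simp [h] at hu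
      have hy0 : y.coeff 0 ≠ 0 := by rintro h; simp [h] at hu
      obtain ⟨a, ha, ha1⟩ := hone (inv_mul_cancel₀ hx0)
      obtain ⟨b, hb, hb1⟩ := hone (inv_mul_cancel₀ hy0)
      have hgab : g = a * b := hinj (by
        rw [hg, Subring.coe_mul, ha, hb, eq_inv_of_mul_eq_one_left hu, mul_inv, Polynomial.C_mul]
        ring)
      have hab : IsCoprime (a : K[X]) b := by
        rw [ha, hb]
        have hux := Polynomial.isUnit_C.2 (inv_ne_zero hx0).isUnit
        have huy := Polynomial.isUnit_C.2 (inv_ne_zero hy0).isUnit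
        rw [isCoprime_mul_unit_left_left hux, isCoprime_mul_unit_left_right huy]
        exact hxy.isCoprime
      rw [hgab, ← Ideal.span_singleton_mul_span_singleton]
      refine (hx _ (inv_mul_cancel₀ hx0) a ha).mul (hy _ (inv_mul_cancel₀ hy0) b hb)
        (span_sup_span_eq_top ha1 hab) ?_
      rw [Ideal.span_singleton_mul_span_singleton]
      exact tIdeal_span_singleton (mul_ne_zero (ne_zero_of_constTerm_eq_one ha1)
        (ne_zero_of_constTerm_eq_one hb1))
  exact key g 1 (by rw [one_mul, coeff_zero_of_constTerm_eq_one hg]) g (by simp)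

/-- X·AK[X] ⊆ A, because X times any polynomial over K lies in R. -/
theorem mem_of_coe_eq_X_mul_mul {A : Ideal (compositeRing D K)} {f : K[X]}
    (hf : f ∈ A.map (compositeRing D K).subtype) {y : compositeRing D K} {k : K[X]}
    (hy : (y : K[X]) = Polynomial.X * f * k) : y ∈ A := by
  suffices h : ∀ k : K[X], ∀ y : compositeRing D K, (y : K[X]) = Polynomial.X * f * k → y ∈ A from
    h k y hy
  clear hy
  refine Submodule.span_induction ?_ ?_ ?_ ?_ hf
  · rintro _ ⟨a, ha, rfl⟩ k y hy
    have : y = a * xMul D k := Subtype.ext (by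
      rw [hy, Subring.coe_mul, coe_xMul]
      change Polynomial.X * (a : K[X]) * k = _
      ring)
    rw [this]
    exact A.mul_mem_right _ ha
  · intro k y hy
    rw [show y = 0 from Subtype.ext (by simpa using hy)]
    exact zero_mem _
  · intro f g _ _ hf hg k y hy
    have : y = xMul D (f * k) + xMul D (g * k) := Subtype.ext (by
      rw [hy, Subring.coe_add, coe_xMul, coe_xMul]; ring)
    rw [this]
    exact add_mem (hf k _ (by rw [coe_xMul]; ring)) (hg k _ (by rw [coe_xMul]; ring))
  · intro c f _ hf k y hy
    exact hf (c * k) y (by rw [hy, smul_eq_mul]; ring)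

theorem exists_eq_X_pow_mul {f : K[X]} (hf : f ≠ 0) :
    ∃ (r : ℕ) (h : K[X]), h.coeff 0 = 1 ∧ Associated f (Polynomial.X ^ r * h) := by
  obtain ⟨h, hh, hdvd⟩ := Polynomial.exists_eq_pow_rootMultiplicity_mul_and_not_dvd f hf 0
  rw [Polynomial.C_0, sub_zero, Polynomial.X_dvd_iff] at hdvd
  rw [Polynomial.C_0, sub_zero] at hh
  refine ⟨f.rootMultiplicity 0, Polynomial.C (h.coeff 0)⁻¹ * h, by simp [hdvd], ?_⟩
  conv_lhs => rw [hh]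
  exact (associated_unit_mul_left _ _
    (Polynomial.isUnit_C.2 (inv_ne_zero hdvd).isUnit)).symm.mul_left _

/-- Every nonzero ideal of `D + X K[X]` is the product of a principal ideal, generated by a
polynomial with constant term `1`, and an ideal `B` lying between `X ^ r K[X]` and
`X ^ (r + 1) K[X]`. -/
theorem exists_eq_span_mul {A : Ideal (compositeRing D K)} (hA : A ≠ ⊥) :
    ∃ (r : ℕ) (h : compositeRing D K) (B : Ideal (compositeRing D K)), constTerm D K h = 1 ∧
      A = Ideal.span {h} * B ∧
      (∀ y : compositeRing D K, Polynomial.X ^ (r + 1) ∣ (y : K[X]) → y ∈ B) ∧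
      (∀ y ∈ B, Polynomial.X ^ r ∣ (y : K[X])) ∧
      (r = 0 → ∃ y ∈ B, constTerm D K y ≠ 0) := by
  obtain ⟨g, hg⟩ := (inferInstance : (A.map (compositeRing D K).subtype).IsPrincipal)
  have hg0 : g ≠ 0 := by
    rintro rfl
    obtain ⟨a, ha, ha0⟩ := Submodule.exists_mem_ne_zero_of_ne_bot hA
    have := Ideal.mem_map_of_mem (compositeRing D K).subtype ha
    rw [hg] at this
    exact ha0 (Subtype.ext (by simpa using this))
  obtain ⟨r, h₀, hh₀, hgh⟩ := exists_eq_X_pow_mul hg0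
  obtain ⟨h, rfl, hh⟩ := exists_coe_eq_of_coeff_zero (D := D) (d := 1) (hh₀.trans (map_one _).symm)
  have hmap : A.map (compositeRing D K).subtype =
      Ideal.span {Polynomial.X ^ r * (h : K[X])} := by
    rw [hg, ← Ideal.span_singleton_eq_span_singleton.2 hgh]
  have hdvd : ∀ a ∈ A, Polynomial.X ^ r * (h : K[X]) ∣ (a : K[X]) := fun a ha =>
    Ideal.mem_span_singleton.1 (hmap ▸ Ideal.mem_map_of_mem (compositeRing D K).subtype ha)
  have hh0 : (h : K[X]) ≠ 0 := by rintro h0; simp [h0] at hh₀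
  have hAB : A = Ideal.span {h} * Submodule.comap (LinearMap.mulLeft _ h) A := by
    apply le_antisymm
    · intro a ha
      obtain ⟨z, rfl⟩ := (dvd_iff_of_constTerm_eq_one hh).2 ((Dvd.intro_left _ rfl).trans (hdvd a ha))
      exact Ideal.mul_mem_mul (Ideal.mem_span_singleton_self h) ha
    · rw [Ideal.span_singleton_mul_le_iff]
      exact fun z hz => hz
  refine ⟨r, h, _, hh, hAB, ?_, ?_, ?_⟩
  -- Since X^r h generates AK[X], the product hy lies in X·AK[X] ⊆ A.
  · rintro y ⟨k, hk⟩
    change h * y ∈ A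
    refine mem_of_coe_eq_X_mul_mul (hmap ▸ Ideal.mem_span_singleton_self _) (k := k) ?_
    rw [Subring.coe_mul, hk]
    ring
  · intro y hy
    have := hdvd _ hy
    rw [LinearMap.mulLeft_apply, Subring.coe_mul, mul_comm] at this
    exact (mul_dvd_mul_iff_left hh0).1 this
  · rintro rfl
    -- If all constant terms of B vanished, AK[X] = hK[X] would lie in XK[X], against h(0) = 1.
    by_contra! hB
    have : A.map (compositeRing D K).subtype ≤ Ideal.span {Polynomial.X} := by
      rw [Ideal.map_le_iff_le_comap]
      intro a ha
      rw [hAB] at ha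
      obtain ⟨z, hz, rfl⟩ := Ideal.mem_span_singleton_mul.1 ha
      obtain ⟨k, rfl⟩ := exists_eq_xMul (hB z hz)
      exact Ideal.mem_span_singleton.2 ⟨h * k, by
        rw [map_mul, Subring.subtype_apply, Subring.subtype_apply, coe_xMul]; ring⟩
    rw [hmap, Ideal.span_singleton_le_span_singleton, Polynomial.X_dvd_iff] at this
    simp [hh₀] at this

theorem X_dvd_iff_constTerm {y : compositeRing D K} :
    (Polynomial.X : K[X]) ∣ y ↔ constTerm D K y = 0 := by
  rw [Polynomial.X_dvd_iff, ← algebraMap_constTerm, FaithfulSMul.algebraMap_eq_zero_iff]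

theorem radical_eq_ker {r : ℕ} (hr : r ≠ 0) {B : Ideal (compositeRing D K)}
    (h₁ : ∀ y : compositeRing D K, Polynomial.X ^ (r + 1) ∣ (y : K[X]) → y ∈ B)
    (h₂ : ∀ y ∈ B, Polynomial.X ^ r ∣ (y : K[X])) :
    B.radical = RingHom.ker (constTerm D K) := by
  apply le_antisymm
  · rw [(RingHom.ker_isPrime (constTerm D K)).radical_le_iff]
    exact fun y hy => RingHom.mem_ker.2 (X_dvd_iff_constTerm.1 ((dvd_pow_self _ hr).trans (h₂ y hy)))
  · intro y hy
    exact ⟨r + 1, h₁ _ (pow_dvd_pow_of_dvd (X_dvd_iff_constTerm.2 (RingHom.mem_ker.1 hy)) (r + 1))⟩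

theorem span_sup_eq_top {r : ℕ} {h : compositeRing D K} (hh : constTerm D K h = 1)
    {B : Ideal (compositeRing D K)}
    (hB : ∀ y : compositeRing D K, Polynomial.X ^ (r + 1) ∣ (y : K[X]) → y ∈ B) :
    Ideal.span {h} ⊔ B = ⊤ := by
  -- X divides 1 - h, so this power is divisible by X^(r+1).
  have hB' : Ideal.span {(1 - h) ^ (r + 1)} ≤ B := by
    rw [Ideal.span_singleton_le_iff_mem]
    refine hB _ (pow_dvd_pow_of_dvd (X_dvd_iff_constTerm.2 ?_) (r + 1))
    rw [map_sub, map_one, hh, sub_self]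
  have hc : IsCoprime h ((1 - h) ^ (r + 1)) := IsCoprime.pow_right ⟨1, 1, by ring⟩
  rw [← Ideal.isCoprime_span_singleton_iff, Ideal.isCoprime_iff_sup_eq] at hc
  exact top_le_iff.1 (hc.ge.trans (sup_le_sup le_rfl hB'))

theorem isURD_compositeRing (hD : IsURD D) : IsURD (compositeRing D K) := by
  rw [isURD_iff] at hD ⊢
  intro A hA ht
  obtain ⟨r, h, B, hh, rfl, h₁, h₂, h₃⟩ := exists_eq_span_mul hA.1
  have htB := tIdeal_eq_of_span_mul (ne_zero_of_constTerm_eq_one hh) ht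
  have hiB := isTInvertible_of_span_mul hA
  refine (hasPacketFactorization_span hh).mul ?_ (span_sup_eq_top hh h₁) ht
  by_cases hr : r = 0
  · subst hr
    -- For r = 0 the lower bound on B is XK[X] itself, so B is pulled back from D.
    have hker : RingHom.ker (constTerm D K) ≤ B := fun y hy =>
      h₁ y (by simpa using X_dvd_iff_constTerm.2 (RingHom.mem_ker.1 hy))
    have hB : (B.map (constTerm D K)).comap (constTerm D K) = B := by
      rw [Ideal.comap_map_of_surjective' _ constTerm_surjective, sup_eq_left]
      exact hker
    have hI : B.map (constTerm D K) ≠ ⊥ := by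
      obtain ⟨y, hy, hy0⟩ := h₃ rfl
      intro h0
      have := Ideal.mem_map_of_mem (constTerm D K) hy
      rw [h0] at this
      exact hy0 (by simpa using this)
    rw [← hB] at htB hiB ⊢
    rw [hasPacketFactorization_comap_iff hI]
    exact hD _ (isTInvertible_of_comap hI hiB) ((tIdeal_comap_eq_iff hI).1 htB)
  · refine (isPacket_iff.2 ⟨hiB, htB, ?_⟩).hasPacketFactorization
    rw [radical_eq_ker hr h₁ h₂]
    exact RingHom.ker_isPrime _

end Decomposition

end URD

theorem mainTheorem10 {D : Type*} [CommRing D] [IsDomain D] {K : Type*} [Field K] [Algebra D K]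
    [IsFractionRing D K] :
    URD.IsURD (URD.compositeRing D K) ↔ URD.IsURD D :=
  ⟨URD.isURD_of_compositeRing, URD.isURD_compositeRing⟩
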